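/- Let $X$ and $Y$ be finite-dimensional real Hilbert spaces (e.g. $\mathbb{R}^n$ and $\mathbb{R}^m$), and let $\overline{\mathbb R}=\mathbb R\cup\{+\infty\}$. Consider the problem $$\text{(P)}\qquad \underset{x\in X}{\text{minimize}}\quad \Phi(x):=f(x)+g(c(x)).$$ Assume that $f:X\to\mathbb R$ is continuously differentiable and convex; that $g:Y\to\overline{\mathbb R}$ is proper, lower semicontinuous (lsc) and convex; that $c:X\to Y$ is continuously differentiable and satisfies $$c(\lambda x+(1-\lambda)x')-\lambda c(x)-(1-\lambda)c(x')\in\operatorname{hzn} g:=\{v\in Y\mid \forall w\in\operatorname{dom} g:\ g(w+v)\le g(w)\}$$ for all $x,x'\in X$ and $\lambda\in[0,1]$; and that (P) is feasible and possesses a minimizer. Let $\Phi^*$ be its minimal value. *Notation.* Let $g^*(y):=\sup_w\{\langle w,y\rangle-g(w)\}$ be the conjugate of $g$ and let $\partial$ be the convex subdifferential. For $y \in Y$ and $\mu>0$ let $$\mathcal L(x,y):=f(x)+\inf_w\{g(w)+\langle y,c(x)-w\rangle\}=f(x)+\langle y,c(x)\rangle-g^*(y),$$ $$\mathcal L_\mu(x,y):=f(x)+\inf_w\Big\{g(w)+\langle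 y,c(x)-w\rangle+\tfrac1{2\mu}\|c(x)-w\|^2\Big\},$$ $\mathcal V(u):=\inf_x\{f(x)+g(c(x)-u)\}$ for $u\in Y$, and $\mathcal M(y):=\inf_x\mathcal L(x,y)$. A feasible point $\bar x$ of (P) is stationary if there is $\bar y\in Y$ with $\nabla_x\mathcal L(\bar x,\bar y)=\nabla f(\bar x)+c'(\bar x)^\top\bar y=0$ and $c(\bar x)\in\partial g^*(\bar y)$. For $\mu>0$, $\operatorname{prox}_{\mu g}(v)$ is the unique minimizer of $w\mapsto\mu g(w)+\frac12\|w-v\|^2$. For a nonempty, convex, compact set $Y_{\rm sg}\subseteq Y$, $\Pi_{Y_{\rm sg}}$ is the projection onto $Y_{\rm sg}$ and $\operatorname{dist}_{Y_{\rm sg}}$ the distance to it. For $\mu > 0$ let $$(\mathrm D_\mu)\qquad \underset{y\in Y}{\text{minimize}}\quad -\mathcal M(y)+\tfrac\mu2\operatorname{dist}^2_{Y_{\rm sg}}(y).$$ *Algorithm (safeguarded augmented Lagrangian method).* Given $y^0\in Y$, $\mu_0>0$, a nonempty, convex, compact set $Y_{\rm sg}\subseteq Y$ and $\beta\in(0,1)$,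 perform for $k=0,1,2,\dots$ the following steps: 1. set $\hat y^k:=\Pi_{Y_{\rm sg}}(y^k)$; 2. select $\varepsilon_k\ge0$ and compute $x^k\in X$ with $\mathcal L_{\mu_k}(x^k,\hat y^k)\le\inf_{x}\mathcal L_{\mu_k}(x,\hat y^k)+\varepsilon_k$; 3. set $z^k:=\operatorname{prox}_{\mu_kg}(c(x^k)+\mu_k\hat y^k)$; 4. set $y^{k+1}:=\hat y^k+\mu_k^{-1}[c(x^k)-z^k]$; 5. set $\mu_{k+1}:=\beta_k\mu_k$ for some $\beta_k\in(0,\beta]\cup\{1\}$. **Theorem 5.8.** Under the above assumptions, suppose that every minimizer of (P) is nonstationary and that $\mathcal V$ is proper and lsc. Let $\{(x^k,z^k,y^k,\hat y^k)\}$ be a sequence generated by the algorithm such that $$\sum_{k=0}^\infty\sqrt{\varepsilon_k/\mu_k}<\infty,$$ and let $\mu\ge0$ be the limit of the nonincreasing sequence $\{\mu_k\}$. Then the following hold. (i) If $\mu=0$, then $\|y^k\|\to\infty$ and $$\limsup_{k\to\infty}\big(f(x^k)+g(z^k)\big)\le\Phi^*.$$ Each accumulation point $\bar x$ of $\{x^k\}$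 is a minimizer of (P). For each subsequence $\{x^k\}_{k\in K}$ with $x^k\to_K\bar x$ for some $\bar x\in X$, we have $z^k\to_Kc(\bar x)$ and $f(x^k)+g(z^k)\to_K\Phi^*$. (ii) If $\mu>0$, then $\{y^k\}$ converges to a solution of $(\mathrm D_\mu)$. -/

import Mathlib

open Set Filter Topology

noncomputable section

namespace CompositeALM

/-! ### Extended-real-valued convex analysis -/

section ConvexAnalysis

variable {H : Type*}

/-- The domain of an extended-real-valued function. -/
def dom (φ : H → EReal) : Set H := {z | φ z < ⊤}

/-- `φ` is proper: its domain is nonempty, and `φ` is finite on its domain. -/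
def IsProper (φ : H → EReal) : Prop :=
  (dom φ).Nonempty ∧ ∀ z ∈ dom φ, φ z ≠ ⊥

/-- `z` is a (global) minimizer of `φ`, with a value different from `+∞`. -/
def IsMinimizer (φ : H → EReal) (z : H) : Prop :=
  z ∈ dom φ ∧ ∀ z', φ z ≤ φ z'

variable [NormedAddCommGroup H] [InnerProductSpace ℝ H]

/-- Convexity of an extended-real-valued function: its epigraph is convex. -/
def IsConvex (φ : H → EReal) : Prop :=
  Convex ℝ {p : H × ℝ | φ p.1 ≤ (p.2 : EReal)}

/-- The horizon `hzn φ`, the set of directions along which `φ` never increases. -/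
def hzn (φ : H → EReal) : Set H :=
  {v | ∀ z ∈ dom φ, φ (z + v) ≤ φ z}

/-- The conjugate `φ*(y) = sup_z (⟨z, y⟩ - φ z)`. -/
def conj (φ : H → EReal) (y : H) : EReal :=
  ⨆ z, ((inner ℝ z y : ℝ) : EReal) - φ z

/-- The subdifferential of `φ` at `zbar`; it is empty unless `φ zbar` is finite. -/
def subdifferential (φ : H → EReal) (zbar : H) : Set H :=
  {y | φ zbar ≠ ⊤ ∧ φ zbar ≠ ⊥ ∧
    ∀ z ∈ dom φ, φ zbar + ((inner ℝ y (z - zbar) : ℝ) : EReal) ≤ φ z}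

/-- The Moreau envelope of `φ` with parameter `γ`. -/
def moreauEnvelope (φ : H → EReal) (γ : ℝ) (z : H) : EReal :=
  ⨅ w, φ w + ((1 / (2 * γ) * ‖w - z‖ ^ 2 : ℝ) : EReal)

/-- `w = prox_φ(z)`: the infimum in the Moreau envelope with parameter `1` is attained at `w`. For
proper, lsc, convex `φ` on a finite-dimensional space there is exactly one such `w`. -/
def IsProx (φ : H → EReal) (z w : H) : Prop :=
  φ w + ((1 / 2 * ‖w - z‖ ^ 2 : ℝ) : EReal) = moreauEnvelope φ 1 z

/-- `p` is the projection of `y` onto `C`: a point of `C` at distance `dist_C(y)` from `y`. For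
nonempty, closed, convex `C` in a finite-dimensional space there is exactly one such `p`. -/
def IsProjection (C : Set H) (y p : H) : Prop :=
  p ∈ C ∧ ‖p - y‖ = Metric.infDist y C

end ConvexAnalysis

/-! ### The composite problem, its Lagrangians, its value function and its dual -/

section Problem

variable {X Y : Type*}
variable [NormedAddCommGroup X] [InnerProductSpace ℝ X]
variable [NormedAddCommGroup Y] [InnerProductSpace ℝ Y]

/-- The objective `Φ(x) = f(x) + g(c(x))` of the composite problem (P). -/
def objective (f : X → ℝ) (g : Y → EReal) (c : X → Y) (x : X) : EReal :=
  (f x : EReal) + g (c x)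

/-- The infimal value `Φ*` of (P). -/
def optimalValue (f : X → ℝ) (g : Y → EReal) (c : X → Y) : EReal :=
  ⨅ x, objective f g c x

/-- The standing assumptions on the fully convex composite problem (P). -/
structure FullyConvex (f : X → ℝ) (g : Y → EReal) (c : X → Y) : Prop where
  f_smooth : ContDiff ℝ 1 f
  f_convex : ConvexOn ℝ univ f
  g_proper : IsProper g
  g_lsc : LowerSemicontinuous g
  g_convex : IsConvex g
  c_smooth : ContDiff ℝ 1 c
  /-- `c` is `(-hzn g)`-convex. -/
  c_convex : ∀ (x x' : X) (t : ℝ), 0 ≤ t → t ≤ 1 →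
    c (t • x + (1 - t) • x') - t • c x - (1 - t) • c x' ∈ hzn g
  feasible : (dom (objective f g c)).Nonempty
  exists_minimizer : ∃ x, IsMinimizer (objective f g c) x

/-- The Lagrangian `L(x, y) = f(x) + inf_z (g(z) + ⟨y, c(x) - z⟩)`. -/
def lagrangian (f : X → ℝ) (g : Y → EReal) (c : X → Y) (x : X) (y : Y) : EReal :=
  (f x : EReal) + ⨅ z, g z + ((inner ℝ y (c x - z) : ℝ) : EReal)

/-- The augmented Lagrangian
`L_μ(x, y) = f(x) + inf_z (g(z) + ⟨y, c(x) - z⟩ + ‖c(x) - z‖² / (2μ))`. -/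
def augLagrangian (f : X → ℝ) (g : Y → EReal) (c : X → Y) (μ : ℝ) (x : X) (y : Y) : EReal :=
  (f x : EReal) + ⨅ z, g z +
    ((inner ℝ y (c x - z) + 1 / (2 * μ) * ‖c x - z‖ ^ 2 : ℝ) : EReal)

/-- A feasible point `x` is stationary if, for some `y`, `∇ₓ L(x, y) = 0` and `c(x) ∈ ∂g*(y)`.
The second condition forces `g*(y)` to be finite, and then `L(·, y)` differs from
`f + ⟨y, c(·)⟩` by the constant `g*(y)`, so that `∇ₓ L(x, y) = ∇f(x) + c'(x)ᵀ y`. -/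
def IsStationaryPoint (f : X → ℝ) (g : Y → EReal) (c : X → Y) (x : X) : Prop :=
  x ∈ dom (objective f g c) ∧
    ∃ y : Y, HasFDerivAt (fun x' => f x' + inner ℝ y (c x')) (0 : X →L[ℝ] ℝ) x ∧
      c x ∈ subdifferential (conj g) y

/-- The value function `V(u) = inf_x (f(x) + g(c(x) - u))`. -/
def valueFunction (f : X → ℝ) (g : Y → EReal) (c : X → Y) (u : Y) : EReal :=
  ⨅ x, (f x : EReal) + g (c x - u)

/-- The dual function `M(y) = inf_x L(x, y)`. -/
def dualFunction (f : X → ℝ) (g : Y → EReal) (c : X → Y) (y : Y) : EReal :=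
  ⨅ x, lagrangian f g c x y

/-- The objective `-M(y) + (μ/2) dist²(y, Ysg)` of the penalized dual problem (D_μ). -/
def penalizedDual (f : X → ℝ) (g : Y → EReal) (c : X → Y) (Ysg : Set Y) (μ : ℝ) (y : Y) :
    EReal :=
  -dualFunction f g c y + ((μ / 2 * Metric.infDist y Ysg ^ 2 : ℝ) : EReal)

/-- The sequences `x, z, y, yhat`, with penalty parameters `μ` and inexactness parameters `ε`, are
generated by the safeguarded augmented Lagrangian method for (P) with safeguarding set `Ysg`. -/
structure IsSafeguardedALM (f : X → ℝ) (g : Y → EReal) (c : X → Y) (Ysg : Set Y) (β : ℝ)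
    (μ ε : ℕ → ℝ) (x : ℕ → X) (z y yhat : ℕ → Y) : Prop where
  nonempty_Ysg : Ysg.Nonempty
  convex_Ysg : Convex ℝ Ysg
  compact_Ysg : IsCompact Ysg
  β_pos : 0 < β
  β_lt_one : β < 1
  μ_zero_pos : 0 < μ 0
  safeguard : ∀ k, IsProjection Ysg (y k) (yhat k)
  ε_nonneg : ∀ k, 0 ≤ ε k
  subproblem : ∀ k, augLagrangian f g c (μ k) (x k) (yhat k) ≤
    (⨅ x', augLagrangian f g c (μ k) x' (yhat k)) + (ε k : EReal)
  z_update : ∀ k, IsProx (fun w => (μ k : EReal) * g w) (c (x k) + μ k • yhat k) (z k)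
  y_update : ∀ k, y (k + 1) = yhat k + (μ k)⁻¹ • (c (x k) - z k)
  μ_update : ∀ k, ∃ b : ℝ, (0 < b ∧ b ≤ β ∨ b = 1) ∧ μ (k + 1) = b * μ k

end Problem

end CompositeALM

end

open CompositeALM

set_option linter.unusedSectionVars false

/-! Everything is read through the perturbation `u = c x - w`. Minimizing the augmented Lagrangian
amounts to minimizing `V(u) + ⟨ŷ, u⟩ + ‖u‖² / (2μ)`, where the value function `V` is convex because
`c` deviates from affinity only along `hzn g`. The exact minimizer `ū` satisfies `-(ŷ + μ⁻¹ ū) ∈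
∂V(ū)`, so the exact multiplier update `T` is a resolvent, hence firmly nonexpansive. By quadratic
growth an inexact step misses `ū` by at most `μ √2 √(ε/μ)`, so the multiplier error is summable
(`SubgradAt.norm_sub_le_of_inexact`).

If the limit of `μ` is positive, `μ` is eventually constant and `y` is an inexact iteration of `T ∘
P`, with `P` the projection. Its range is bounded, so a fixed point exists, the iteration converges
to one (`tendsto_fixedPoint_of_summable_errors`), and fixed points solve the penalized dual
(`IsProper.isMinimizer_penalizedDual`).

If the limit is zero, testing with `u = 0` bounds the objective values, and an affine minorant of
`V` in `‖u‖` forces `c x - z → 0`. A bounded subsequence of multipliers would then yield a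
subgradient of `V` at the origin, making every minimizer stationary. -/

namespace CompositeALM

/-! ### Firmly nonexpansive operators and their inexact iteration -/

section Nonexpansive

variable {H : Type*} [NormedAddCommGroup H] [InnerProductSpace ℝ H]

/-- A firmly nonexpansive operator. -/
def FirmlyNonexpansive (T : H → H) : Prop :=
  ∀ a b, ‖T a - T b‖ ^ 2 ≤ inner ℝ (T a - T b) (a - b)

theorem FirmlyNonexpansive.sq_norm_add_le {T : H → H} (hT : FirmlyNonexpansive T) (a b : H) :
    ‖T a - T b‖ ^ 2 + ‖(a - b) - (T a - T b)‖ ^ 2 ≤ ‖a - b‖ ^ 2 := by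
  have h := hT a b
  rw [norm_sub_sq_real (a - b), real_inner_comm]
  linarith

theorem FirmlyNonexpansive.norm_sub_le {T : H → H} (hT : FirmlyNonexpansive T) (a b : H) :
    ‖T a - T b‖ ≤ ‖a - b‖ := by
  have h := hT.sq_norm_add_le a b
  refine le_of_sq_le_sq ?_ (norm_nonneg _)
  nlinarith [sq_nonneg ‖(a - b) - (T a - T b)‖]

theorem half_sq_norm_add_le (a b : H) : 1 / 2 * ‖a + b‖ ^ 2 ≤ ‖a‖ ^ 2 + ‖b‖ ^ 2 := by
  have h1 := norm_add_sq_real a b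
  have h2 := norm_sub_sq_real a b
  nlinarith [sq_nonneg ‖a - b‖]

/-- The two residual inequalities telescope. The two displacements add up to `a - T (P a)`, and
merging their squares costs the factor 1/2. -/
theorem FirmlyNonexpansive.comp_sq_norm_le {T P : H → H} (hT : FirmlyNonexpansive T)
    (hP : FirmlyNonexpansive P) {p : H} (hp : T (P p) = p) (a : H) :
    ‖T (P a) - p‖ ^ 2 + 1 / 2 * ‖a - T (P a)‖ ^ 2 ≤ ‖a - p‖ ^ 2 := by
  have h1 := hT.sq_norm_add_le (P a) (P p)
  have h2 := hP.sq_norm_add_le a p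
  have h3 := half_sq_norm_add_le ((P a - P p) - (T (P a) - T (P p))) ((a - p) - (P a - P p))
  rw [hp] at h1 h3
  have h4 : (P a - P p) - (T (P a) - p) + ((a - p) - (P a - P p)) = a - T (P a) := by abel
  rw [h4] at h3
  linarith

/-- A nonexpansive map with bounded range on a finite-dimensional space has a fixed point. -/
theorem exists_fixedPoint_of_nonexpansive [FiniteDimensional ℝ H] {F : H → H}
    (hF : ∀ a b, ‖F a - F b‖ ≤ ‖a - b‖) {R : ℝ} (hR : ∀ a, ‖F a‖ ≤ R) : ∃ p, F p = p := by
  have hR0 : 0 ≤ R := (norm_nonneg _).trans (hR 0)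
  have : ProperSpace H := FiniteDimensional.proper_real H
  have : CompleteSpace H := FiniteDimensional.complete ℝ H
  -- Damping turns `F` into a contraction. Its fixed points are almost fixed by `F`, since the range
  -- is bounded; compactness supplies a limit.
  have hx : ∀ n : ℕ, ∃ a, (1 - 1 / ((n : ℝ) + 2)) • F a = a := by
    intro n
    have hn : (0 : ℝ) < n + 2 := by positivity
    have ht0 : (0 : ℝ) < 1 / (n + 2) := by positivity
    have ht1 : 1 / ((n : ℝ) + 2) ≤ 1 := by rw [div_le_one hn]; linarith
    have hc : ContractingWith (Real.toNNReal (1 - 1 / ((n : ℝ) + 2)))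
        (fun a => (1 - 1 / ((n : ℝ) + 2)) • F a) := by
      refine ⟨?_, LipschitzWith.of_dist_le_mul fun a b => ?_⟩
      · rw [← NNReal.coe_lt_coe, Real.coe_toNNReal _ (by linarith)]
        simp only [NNReal.coe_one]
        linarith
      · rw [Real.coe_toNNReal _ (by linarith), dist_eq_norm, dist_eq_norm, ← smul_sub, norm_smul,
          Real.norm_of_nonneg (by linarith)]
        exact mul_le_mul_of_nonneg_left (hF a b) (by linarith)
    exact ⟨_, hc.fixedPoint_isFixedPt⟩
  choose a ha using hx
  have hdiff : ∀ n, ‖F (a n) - a n‖ ≤ R * (1 / ((n : ℝ) + 2)) := by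
    intro n
    have h1 : F (a n) - a n = (1 / ((n : ℝ) + 2)) • F (a n) := by
      nth_rw 2 [← ha n]
      rw [sub_smul, one_smul]
      abel
    rw [h1, norm_smul, Real.norm_of_nonneg (by positivity), mul_comm]
    exact mul_le_mul_of_nonneg_right (hR _) (by positivity)
  have hbd : ∀ n, a n ∈ Metric.closedBall (0 : H) R := by
    intro n
    have hn : (0 : ℝ) < n + 2 := by positivity
    have ht0 : (0 : ℝ) < 1 / (n + 2) := by positivity
    have ht1 : 1 / ((n : ℝ) + 2) ≤ 1 := by rw [div_le_one hn]; linarith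
    rw [mem_closedBall_zero_iff, ← ha n, norm_smul, Real.norm_of_nonneg (by linarith)]
    nlinarith [hR (a n), norm_nonneg (F (a n))]
  obtain ⟨p, -, κ, hκ, hp⟩ := (isCompact_closedBall (0 : H) R).tendsto_subseq hbd
  have hFc : Continuous F := by
    refine (LipschitzWith.of_dist_le_mul (K := 1) fun a b => ?_).continuous
    simpa [dist_eq_norm] using hF a b
  have h0 : Tendsto (fun n => F (a n) - a n) atTop (𝓝 0) := by
    refine squeeze_zero_norm hdiff ?_
    have h := tendsto_one_div_add_atTop_nhds_zero_nat (𝕜 := ℝ)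
    have h' := ((tendsto_add_atTop_iff_nat 1).2 h).const_mul R
    rw [mul_zero] at h'
    refine h'.congr fun n => ?_
    push_cast
    ring
  have h1 := (((hFc.tendsto p).comp hp).sub hp)
  have h2 := tendsto_nhds_unique h1 (h0.comp hκ.tendsto_atTop)
  exact ⟨p, sub_eq_zero.1 h2⟩

theorem exists_tendsto_of_le_add_summable {a e : ℕ → ℝ} (ha : ∀ k, 0 ≤ a k) (he : Summable e)
    (he0 : ∀ k, 0 ≤ e k) (h : ∀ k, a (k + 1) ≤ a k + e k) : ∃ l, Tendsto a atTop (𝓝 l) := by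
  have hanti : Antitone fun k => a k - ∑ i ∈ Finset.range k, e i := by
    refine antitone_nat_of_succ_le fun k => ?_
    rw [Finset.sum_range_succ]
    linarith [h k]
  have hbdd : BddBelow (range fun k => a k - ∑ i ∈ Finset.range k, e i) := by
    refine ⟨-∑' i, e i, ?_⟩
    rintro _ ⟨k, rfl⟩
    have := he.sum_le_tsum (Finset.range k) fun i _ => he0 i
    simp only
    linarith [ha k]
  have h1 := (tendsto_atTop_ciInf hanti hbdd).add he.hasSum.tendsto_sum_nat
  exact ⟨_, h1.congr fun k => by ring⟩

/-- Inexact fixed-point iterations of a composition of two firmly nonexpansive operators converge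
to a fixed point as soon as there is one and the errors are summable. -/
theorem tendsto_fixedPoint_of_summable_errors [FiniteDimensional ℝ H] {T P : H → H}
    (hT : FirmlyNonexpansive T) (hP : FirmlyNonexpansive P) (hfix : ∃ p, T (P p) = p)
    {y : ℕ → H} {e : ℕ → ℝ} (he : Summable e) (hy : ∀ k, ‖y (k + 1) - T (P (y k))‖ ≤ e k) :
    ∃ p, T (P p) = p ∧ Tendsto y atTop (𝓝 p) := by
  have : ProperSpace H := FiniteDimensional.proper_real H
  have he0 : ∀ k, 0 ≤ e k := fun k => (norm_nonneg _).trans (hy k)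
  have hF : ∀ a b, ‖T (P a) - T (P b)‖ ≤ ‖a - b‖ := fun a b =>
    (hT.norm_sub_le _ _).trans (hP.norm_sub_le _ _)
  have hconv : ∀ p, T (P p) = p → ∃ l, Tendsto (fun k => ‖y k - p‖) atTop (𝓝 l) := by
    intro p hp
    refine exists_tendsto_of_le_add_summable (fun k => norm_nonneg _) he he0 fun k => ?_
    have h1 := hF (y k) p
    rw [hp] at h1
    have h2 := norm_sub_le_norm_sub_add_norm_sub (y (k + 1)) (T (P (y k))) p
    linarith [hy k]
  obtain ⟨p, hp⟩ := hfix
  obtain ⟨l, hl⟩ := hconv p hp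
  have he_lim := he.tendsto_atTop_zero
  -- The distances to `p` before and after an exact step share the limit `l`; their squared
  -- difference controls the residual.
  have hres : Tendsto (fun k => ‖y k - T (P (y k))‖ ^ 2) atTop (𝓝 0) := by
    have hl' : Tendsto (fun k => ‖y (k + 1) - p‖) atTop (𝓝 l) := (tendsto_add_atTop_iff_nat 1).2 hl
    have hlow : ∀ k, ‖y (k + 1) - p‖ - e k ≤ ‖T (P (y k)) - p‖ := fun k => by
      have h2 := norm_sub_le_norm_sub_add_norm_sub (y (k + 1)) (T (P (y k))) p
      linarith [hy k]
    have hup : ∀ k, ‖T (P (y k)) - p‖ ≤ ‖y k - p‖ := fun k => by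
      have h1 := hF (y k) p
      rwa [hp] at h1
    have hTl : Tendsto (fun k => ‖T (P (y k)) - p‖) atTop (𝓝 l) :=
      tendsto_of_tendsto_of_tendsto_of_le_of_le (by simpa using hl'.sub he_lim) hl hlow hup
    have h0 : Tendsto (fun k => 2 * (‖y k - p‖ ^ 2 - ‖T (P (y k)) - p‖ ^ 2)) atTop (𝓝 0) := by
      simpa using ((hl.pow 2).sub (hTl.pow 2)).const_mul 2
    refine squeeze_zero (fun k => sq_nonneg _) (fun k => ?_) h0
    have := hT.comp_sq_norm_le hP hp (y k)
    linarith
  have hres' : Tendsto (fun k => y k - T (P (y k))) atTop (𝓝 0) := by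
    rw [tendsto_zero_iff_norm_tendsto_zero]
    simpa using hres.sqrt
  obtain ⟨R, hR⟩ := hl.bddAbove_range
  have hbd : ∀ k, y k ∈ Metric.closedBall p R := fun k => by
    rw [mem_closedBall_iff_norm]
    exact hR ⟨k, rfl⟩
  obtain ⟨q, -, κ, hκ, hq⟩ := (isCompact_closedBall p R).tendsto_subseq hbd
  have hFc : Continuous fun a => T (P a) := by
    refine (LipschitzWith.of_dist_le_mul (K := 1) fun a b => ?_).continuous
    simpa [dist_eq_norm] using hF a b
  have hfq : T (P q) = q := by
    have h1 := hq.sub ((hFc.tendsto q).comp hq)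
    have h2 := tendsto_nhds_unique h1 (hres'.comp hκ.tendsto_atTop)
    exact (sub_eq_zero.1 h2).symm
  -- The cluster point `q` is itself a fixed point, so the distance to it converges along the whole
  -- sequence; the subsequence identifies the limit as 0.
  obtain ⟨m, hm⟩ := hconv q hfq
  have h1 : Tendsto (fun j => ‖y (κ j) - q‖) atTop (𝓝 0) := by
    simpa using (hq.sub_const q).norm
  have hm0 : m = 0 := tendsto_nhds_unique (hm.comp hκ.tendsto_atTop) h1
  subst hm0
  exact ⟨q, hfq, tendsto_iff_norm_sub_tendsto_zero.2 hm⟩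

end Nonexpansive

/-! ### Projections onto convex sets -/

section Projection

variable {H : Type*} [NormedAddCommGroup H] [InnerProductSpace ℝ H] {C : Set H}

theorem IsProjection.inner_le_zero (hC : Convex ℝ C) {a p : H} (h : IsProjection C a p) :
    ∀ w ∈ C, inner ℝ (a - p) (w - p) ≤ 0 := by
  refine (norm_eq_iInf_iff_real_inner_le_zero hC h.1).1 ?_
  rw [norm_sub_rev, h.2, Metric.infDist_eq_iInf]
  simp [dist_eq_norm]

theorem IsProjection.firm (hC : Convex ℝ C) {a b p q : H} (hp : IsProjection C a p)
    (hq : IsProjection C b q) : ‖p - q‖ ^ 2 ≤ inner ℝ (p - q) (a - b) := by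
  have h1 := hp.inner_le_zero hC q hq.1
  have h2 := hq.inner_le_zero hC p hp.1
  have h3 : inner ℝ (p - q) (a - b) - inner ℝ (p - q) (p - q) =
      - (inner ℝ (a - p) (q - p) + inner ℝ (b - q) (p - q)) := by
    rw [← neg_sub p q, inner_neg_right, ← real_inner_comm (a - p), ← real_inner_comm (b - q),
      ← inner_sub_right]
    have : a - b - (p - q) = (a - p) - (b - q) := by abel
    rw [this, inner_sub_right]
    ring
  rw [real_inner_self_eq_norm_sq] at h3
  linarith

theorem IsProjection.unique (hC : Convex ℝ C) {a p q : H} (hp : IsProjection C a p)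
    (hq : IsProjection C a q) : p = q := by
  have h := hp.firm hC hq
  rw [sub_self, inner_zero_right] at h
  have : ‖p - q‖ = 0 := by nlinarith [norm_nonneg (p - q)]
  exact sub_eq_zero.1 (norm_eq_zero.1 this)

theorem exists_isProjection (hC : IsCompact C) (hne : C.Nonempty) (a : H) :
    ∃ p, IsProjection C a p := by
  obtain ⟨p, hp, h⟩ := hC.exists_infDist_eq_dist hne a
  exact ⟨p, hp, by rw [h, dist_comm, dist_eq_norm]⟩

/-- The subgradient inequality for half the squared distance to a convex set. -/
theorem IsProjection.half_sq_infDist_le (hC : Convex ℝ C) {a b p q : H} (hp : IsProjection C a p)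
    (hq : IsProjection C b q) :
    1 / 2 * Metric.infDist a C ^ 2 + inner ℝ (a - p) (b - a) ≤ 1 / 2 * Metric.infDist b C ^ 2 := by
  have h1 := hp.inner_le_zero hC q hq.1
  rw [← hp.2, ← hq.2, norm_sub_rev p, norm_sub_rev q]
  have h2 : b - a = (b - q) - (a - p) + (q - p) := by abel
  rw [h2, inner_add_right, inner_sub_right, real_inner_self_eq_norm_sq]
  have h3 := norm_sub_sq_real (a - p) (b - q)
  nlinarith [sq_nonneg ‖a - p - (b - q)‖]

end Projection

/-! ### Subgradients and the quadratically perturbed subproblem -/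

section ProximalStep

variable {H : Type*} [NormedAddCommGroup H] [InnerProductSpace ℝ H] {h : H → EReal}

theorem IsConvex.segment_le (hh : IsConvex h) {a b : H} {s r t : ℝ} (ha : h a ≤ s) (hb : h b ≤ r)
    (ht0 : 0 ≤ t) (ht1 : t ≤ 1) :
    h ((1 - t) • a + t • b) ≤ (((1 - t) * s + t * r : ℝ) : EReal) := by
  have h1 := hh (x := (a, s)) ha (y := (b, r)) hb (a := 1 - t) (b := t) (by linarith) ht0 (by ring)
  simpa using h1

/-- A convex function that is lower semicontinuous at the origin and finite there is minorized by
an affine function of the norm. -/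
theorem IsConvex.exists_norm_minorant (hh : IsConvex h) (hlsc : LowerSemicontinuous h) {v : ℝ}
    (h0 : h 0 = v) : ∃ b : ℝ, 0 ≤ b ∧ ∀ u (s : ℝ), h u ≤ s → v - 1 - b * ‖u‖ ≤ s := by
  have h1 : ∀ᶠ u in 𝓝 (0 : H), ((v - 1 : ℝ) : EReal) < h u := by
    refine hlsc 0 _ ?_
    change ((v - 1 : ℝ) : EReal) < h 0
    rw [h0]
    exact_mod_cast sub_one_lt v
  obtain ⟨δ, hδ, hball⟩ := Metric.eventually_nhds_iff.1 h1
  refine ⟨2 / δ, by positivity, fun u s hs => ?_⟩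
  rcases lt_or_ge ‖u‖ δ with hu | hu
  · have h2 := (hball (y := u) (by simpa using hu)).trans_le hs
    have h3 : v - 1 < s := by exact_mod_cast h2
    have : 0 ≤ 2 / δ * ‖u‖ := by positivity
    linarith
  · have hu0 : 0 < ‖u‖ := hδ.trans_le hu
    -- Pulls `u` back to norm `δ / 2`, where `h` exceeds `v - 1`; convexity then gives `s > v - 1 /
    -- t`, with `1 / t = 2 / δ * ‖u‖`.
    set t := δ / (2 * ‖u‖) with ht
    have ht0 : 0 < t := by positivity
    have ht1 : t ≤ 1 := by rw [ht, div_le_one (by positivity)]; linarith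
    have h2 := hh.segment_le h0.le hs ht0.le ht1
    have h3 : ‖t • u‖ < δ := by
      rw [norm_smul, Real.norm_of_nonneg ht0.le, ht]
      have : δ / (2 * ‖u‖) * ‖u‖ = δ / 2 := by field_simp
      linarith
    rw [smul_zero, zero_add] at h2
    have h4 := (hball (y := t • u) (by simpa using h3)).trans_le h2
    have h5 : v - 1 < (1 - t) * v + t * s := by exact_mod_cast h4
    have h6 : 2 / δ * ‖u‖ * t = 1 := by rw [ht]; field_simp
    by_contra hcon
    push Not at hcon
    have h7 : t * s < t * (v - 1 - 2 / δ * ‖u‖) := mul_lt_mul_of_pos_left hcon ht0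
    nlinarith

/-- The quadratic perturbation `⟨a, u⟩ + ‖u‖² / (2γ)` of the augmented Lagrangian. -/
noncomputable def quad (γ : ℝ) (a u : H) : ℝ := inner ℝ a u + 1 / (2 * γ) * ‖u‖ ^ 2

theorem quad_zero (γ : ℝ) (a : H) : quad γ a 0 = 0 := by simp [quad]

theorem neg_le_quad {γ : ℝ} (hγ : 0 < γ) (a u : H) : -(γ / 2 * ‖a‖ ^ 2) ≤ quad γ a u := by
  have h1 : quad γ a u = 1 / (2 * γ) * ‖u + γ • a‖ ^ 2 - γ / 2 * ‖a‖ ^ 2 := by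
    rw [quad, norm_add_sq_real, inner_smul_right, norm_smul, Real.norm_of_nonneg hγ.le,
      real_inner_comm]
    field_simp
    ring
  rw [h1]
  have : 0 ≤ 1 / (2 * γ) * ‖u + γ • a‖ ^ 2 := by positivity
  linarith

theorem quad_expand {γ : ℝ} (hγ : 0 < γ) (a u w : H) :
    quad γ a u = quad γ a w + inner ℝ (a + γ⁻¹ • w) (u - w) + 1 / (2 * γ) * ‖u - w‖ ^ 2 := by
  rw [quad, quad, inner_add_left, inner_smul_left, inner_sub_right, inner_sub_right,
    real_inner_self_eq_norm_sq, norm_sub_sq_real, real_inner_comm w u]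
  simp only [conj_trivial]
  field_simp
  ring

/-- The augmented Lagrangian subproblem has an exact solution in terms of the perturbation. -/
theorem IsConvex.exists_quad_minimizer [FiniteDimensional ℝ H] (hh : IsConvex h)
    (hlsc : LowerSemicontinuous h) {v : ℝ} (h0 : h 0 = v) {γ : ℝ} (hγ : 0 < γ) (a : H) :
    ∃ (ubar : H) (r : ℝ), h ubar = r ∧
      ∀ u (s : ℝ), h u ≤ s → r + quad γ a ubar ≤ s + quad γ a u := by
  have : ProperSpace H := FiniteDimensional.proper_real H
  obtain ⟨b, hb, hmin⟩ := hh.exists_norm_minorant hlsc h0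
  -- Outside this radius the quadratic outweighs both linear terms by at least 1, so values there
  -- are no smaller than `v`, the value at the origin.
  set R := 2 * γ * (b + ‖a‖) + 2 * γ + 1 with hR
  have hR0 : 0 ≤ R := by positivity
  have hbot : ∀ u, h u ≠ ⊥ := fun u hu => by
    have := hmin u (v - 1 - b * ‖u‖ - 1) (by rw [hu]; exact bot_le)
    linarith
  have hq : Continuous fun u => ((quad γ a u : ℝ) : EReal) := by
    refine continuous_coe_real_ereal.comp ?_
    unfold quad
    fun_prop
  have hφ : LowerSemicontinuous fun u => h u + ((quad γ a u : ℝ) : EReal) :=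
    hlsc.add' hq.lowerSemicontinuous fun u =>
      EReal.continuousAt_add (Or.inr (EReal.coe_ne_bot _)) (Or.inr (EReal.coe_ne_top _))
  obtain ⟨ubar, -, hubar⟩ := LowerSemicontinuousOn.exists_isMinOn
    ⟨(0 : H), Metric.mem_closedBall_self hR0⟩ (isCompact_closedBall (0 : H) R)
    (hφ.lowerSemicontinuousOn _)
  have hb0 := hubar (Metric.mem_closedBall_self hR0)
  simp only [mem_ofPred_eq, h0, quad_zero, EReal.coe_zero, add_zero] at hb0
  have htop : h ubar ≠ ⊤ := fun hu => by
    rw [hu, EReal.top_add_coe] at hb0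
    exact absurd hb0 (by simp)
  obtain ⟨r, hr⟩ : ∃ r : ℝ, h ubar = r := ⟨(h ubar).toReal, (EReal.coe_toReal htop (hbot _)).symm⟩
  rw [hr] at hb0
  have hb0' : r + quad γ a ubar ≤ v := by exact_mod_cast hb0
  refine ⟨ubar, r, hr, fun u s hs => ?_⟩
  rcases le_or_gt ‖u‖ R with hu | hu
  · have h1 := hubar (show u ∈ Metric.closedBall (0 : H) R by simpa using hu)
    simp only [mem_ofPred_eq] at h1
    rw [hr] at h1
    have h2 := h1.trans (add_le_add_left hs _)
    exact_mod_cast h2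
  · have h1 := hmin u s hs
    have h2 : -(‖a‖ * ‖u‖) ≤ inner ℝ a u := (abs_le.1 (abs_real_inner_le_norm a u)).1
    have h3 : 1 + (b + ‖a‖) * ‖u‖ ≤ 1 / (2 * γ) * ‖u‖ ^ 2 := by
      rw [div_mul_eq_mul_div, le_div_iff₀ (by positivity), one_mul]
      have hu1 : 1 ≤ ‖u‖ := by
        have : 0 ≤ 2 * γ * (b + ‖a‖) + 2 * γ := by positivity
        linarith
      have h4 : R * ‖u‖ ≤ ‖u‖ * ‖u‖ := mul_le_mul_of_nonneg_right hu.le (norm_nonneg u)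
      rw [hR] at h4
      nlinarith
    refine hb0'.trans ?_
    unfold quad
    linarith

/-- `w` is a subgradient of `h` at `u`, where `h` takes the value `r`. -/
def SubgradAt (h : H → EReal) (u : H) (r : ℝ) (w : H) : Prop :=
  h u = r ∧ ∀ u' (s : ℝ), h u' ≤ s → r + inner ℝ w (u' - u) ≤ s

/-- First-order condition at the minimizer: compare it with points of a segment, divide by `t` and
let `t → 0`. -/
theorem IsConvex.exists_subgradAt [FiniteDimensional ℝ H] (hh : IsConvex h)
    (hlsc : LowerSemicontinuous h) {v : ℝ} (h0 : h 0 = v) {γ : ℝ} (hγ : 0 < γ) (a : H) :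
    ∃ (ubar : H) (r : ℝ), SubgradAt h ubar r (-(a + γ⁻¹ • ubar)) := by
  obtain ⟨ubar, r, hr, hmin⟩ := hh.exists_quad_minimizer hlsc h0 hγ a
  refine ⟨ubar, r, hr, fun u s hs => ?_⟩
  rw [inner_neg_left]
  set d := u - ubar with hd
  set i := inner ℝ (a + γ⁻¹ • ubar) d with hi
  have key : ∀ t : ℝ, 0 < t → t ≤ 1 → 0 ≤ (s - r) + i + t * (1 / (2 * γ) * ‖d‖ ^ 2) := by
    intro t ht0 ht1
    have h1 := hmin _ _ (hh.segment_le hr.le hs ht0.le ht1)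
    have h2 : (1 - t) • ubar + t • u - ubar = t • d := by
      rw [hd, smul_sub, sub_smul, one_smul]
      abel
    rw [quad_expand hγ a ((1 - t) • ubar + t • u) ubar, h2, inner_smul_right, norm_smul, Real.norm_of_nonneg ht0.le] at h1
    have h3 : 0 ≤ t * ((s - r) + i + t * (1 / (2 * γ) * ‖d‖ ^ 2)) := by
      nlinarith
    exact nonneg_of_mul_nonneg_right h3 ht0
  have hlim : Tendsto (fun t : ℝ => (s - r) + i + t * (1 / (2 * γ) * ‖d‖ ^ 2)) (𝓝[>] 0)
      (𝓝 ((s - r) + i + 0 * (1 / (2 * γ) * ‖d‖ ^ 2))) := by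
    refine Tendsto.mono_left ?_ nhdsWithin_le_nhds
    exact (Continuous.tendsto (by fun_prop) 0)
  have h0le := ge_of_tendsto hlim (by
    filter_upwards [Ioc_mem_nhdsGT (zero_lt_one' ℝ)] with t ht
    exact key t ht.1 ht.2)
  linarith

/-- Quadratic growth at the solution of the exact subproblem. -/
theorem SubgradAt.quad_growth {γ : ℝ} (hγ : 0 < γ) {a ubar : H} {r : ℝ}
    (hs : SubgradAt h ubar r (-(a + γ⁻¹ • ubar))) {u : H} {s : ℝ} (hu : h u ≤ s) :
    r + quad γ a ubar + 1 / (2 * γ) * ‖u - ubar‖ ^ 2 ≤ s + quad γ a u := by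
  have h1 := hs.2 u s hu
  rw [quad_expand hγ a u ubar]
  rw [inner_neg_left] at h1
  linarith

theorem SubgradAt.monotone {u u' w w' : H} {r r' : ℝ} (h1 : SubgradAt h u r w)
    (h2 : SubgradAt h u' r' w') : 0 ≤ inner ℝ (w - w') (u - u') := by
  have h3 := h1.2 u' r' h2.1.le
  have h4 := h2.2 u r h1.1.le
  rw [← neg_sub u u', inner_neg_right] at h3
  rw [inner_sub_left]
  linarith

/-- The multiplier update with exactly solved subproblems is firmly nonexpansive. -/
theorem firmlyNonexpansive_of_subgradAt {γ : ℝ} (hγ : 0 < γ) {U : H → H} {r : H → ℝ}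
    (hU : ∀ a, SubgradAt h (U a) (r a) (-(a + γ⁻¹ • U a))) :
    FirmlyNonexpansive fun a => a + γ⁻¹ • U a := by
  intro a b
  -- With `T a = a + γ⁻¹ • U a`, the subgradient at `U a` is `-T a` and `U a = γ • (T a - a)`;
  -- monotonicity divided by `γ` is the claim.
  have h1 := (hU a).monotone (hU b)
  have h2 : -(a + γ⁻¹ • U a) - -(b + γ⁻¹ • U b) = -((a + γ⁻¹ • U a) - (b + γ⁻¹ • U b)) := by abel
  have h3 : U a - U b = γ • (((a + γ⁻¹ • U a) - (b + γ⁻¹ • U b)) - (a - b)) := by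
    have : ((a + γ⁻¹ • U a) - (b + γ⁻¹ • U b)) - (a - b) = γ⁻¹ • (U a - U b) := by
      rw [smul_sub]; abel
    rw [this, smul_smul, mul_inv_cancel₀ hγ.ne', one_smul]
  rw [h2, h3, inner_neg_left, inner_smul_right, inner_sub_right, real_inner_self_eq_norm_sq] at h1
  have h4 : 0 ≤ γ * (inner ℝ ((a + γ⁻¹ • U a) - (b + γ⁻¹ • U b)) (a - b)
      - ‖(a + γ⁻¹ • U a) - (b + γ⁻¹ • U b)‖ ^ 2) := by linarith
  have h5 := nonneg_of_mul_nonneg_right h4 hγ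
  simp only
  linarith

/-- The graph of the subdifferential of a lower semicontinuous function is closed. -/
theorem SubgradAt.of_tendsto (hlsc : LowerSemicontinuous h) {u : ℕ → H} {r : ℕ → ℝ} {w : ℕ → H}
    (hs : ∀ j, SubgradAt h (u j) (r j) (w j)) {ulim wlim : H} {v : ℝ} (hv : h ulim = v)
    (hu : Tendsto u atTop (𝓝 ulim)) (hw : Tendsto w atTop (𝓝 wlim)) :
    SubgradAt h ulim v wlim := by
  refine ⟨hv, fun u' s hs' => ?_⟩
  -- The values `r j` are not known to converge to `v`; eventually exceeding each `m < v` is enough.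
  refine le_of_forall_lt fun q hq => ?_
  obtain ⟨m, hm1, hm2⟩ := exists_between (sub_lt_iff_lt_add.2 hq)
  have hlt : ∀ᶠ j in atTop, ((m : ℝ) : EReal) < h (u j) :=
    hu.eventually (hlsc ulim _ (by
      change ((m : ℝ) : EReal) < h ulim
      rw [hv]
      exact_mod_cast hm2))
  have hlim : Tendsto (fun j => m + inner ℝ (w j) (u' - u j)) atTop
      (𝓝 (m + inner ℝ wlim (u' - ulim))) :=
    (hw.inner (hu.const_sub u')).const_add m
  have h1 : m + inner ℝ wlim (u' - ulim) ≤ s := by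
    refine le_of_tendsto hlim ?_
    filter_upwards [hlt] with j hj
    rw [(hs j).1] at hj
    have hj' : m < r j := by exact_mod_cast hj
    linarith [(hs j).2 u' s hs']
  linarith

end ProximalStep

/-! ### The value function, the Lagrangians and the dual problem -/

section Composite

variable {X Y : Type*} [NormedAddCommGroup X] [InnerProductSpace ℝ X]
  [NormedAddCommGroup Y] [InnerProductSpace ℝ Y] {f : X → ℝ} {g : Y → EReal} {c : X → Y}

theorem IsProper.ne_bot (hg : IsProper g) (w : Y) : g w ≠ ⊥ := fun h =>
  hg.2 w (by simp [dom, h]) h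

theorem IsProper.exists_real (hg : IsProper g) {w : Y} (hw : g w < ⊤) : ∃ r : ℝ, g w = r :=
  ⟨(g w).toReal, (EReal.coe_toReal hw.ne (hg.ne_bot w)).symm⟩

/-- The proximal point minimizes the objective in the definition of the augmented Lagrangian. -/
theorem IsProper.prox_minimizes (hg : IsProper g) {γ : ℝ} (hγ : 0 < γ) {a b z : Y}
    (h : IsProx (fun w => (γ : EReal) * g w) (a + γ • b) z) :
    ∃ r : ℝ, g z = r ∧
      ∀ w (s : ℝ), g w ≤ s → r + quad γ b (a - z) ≤ s + quad γ b (a - w) := by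
  -- Completing the square: the proximal objective is `γ` times the augmented Lagrangian integrand,
  -- up to a constant.
  have hsq : ∀ w : Y, 1 / 2 * ‖w - (a + γ • b)‖ ^ 2 =
      γ * quad γ b (a - w) + γ ^ 2 / 2 * ‖b‖ ^ 2 := fun w => by
    have h1 : w - (a + γ • b) = -((a - w) + γ • b) := by abel
    rw [h1, norm_neg, norm_add_sq_real, quad, inner_smul_right, norm_smul,
      Real.norm_of_nonneg hγ.le, real_inner_comm]
    field_simp
    ring
  have hle : ∀ w, (γ : EReal) * g z + ((1 / 2 * ‖z - (a + γ • b)‖ ^ 2 : ℝ) : EReal) ≤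
      (γ : EReal) * g w + ((1 / 2 * ‖w - (a + γ • b)‖ ^ 2 : ℝ) : EReal) := fun w => by
    have h1 := h
    unfold IsProx moreauEnvelope at h1
    rw [h1]
    refine (iInf_le _ w).trans_eq ?_
    norm_num
  have hz : g z < ⊤ := by
    refine lt_top_iff_ne_top.2 fun hz => ?_
    obtain ⟨w, hw⟩ := hg.1
    obtain ⟨s, hs⟩ := hg.exists_real hw
    have h1 := hle w
    rw [hz, EReal.coe_mul_top_of_pos hγ, EReal.top_add_coe, hs, top_le_iff] at h1
    exact absurd h1 (by exact_mod_cast EReal.coe_ne_top _)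
  obtain ⟨r, hr⟩ := hg.exists_real hz
  refine ⟨r, hr, fun w s hws => ?_⟩
  obtain ⟨t, ht⟩ := hg.exists_real (hws.trans_lt (EReal.coe_lt_top s))
  have h1 := hle w
  rw [hr, ht, hsq, hsq] at h1
  have h2 : γ * r + (γ * quad γ b (a - z) + γ ^ 2 / 2 * ‖b‖ ^ 2) ≤
      γ * t + (γ * quad γ b (a - w) + γ ^ 2 / 2 * ‖b‖ ^ 2) := by exact_mod_cast h1
  have h3 : t ≤ s := by rw [ht] at hws; exact_mod_cast hws
  have h4 : r + quad γ b (a - z) ≤ t + quad γ b (a - w) := by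
    refine le_of_mul_le_mul_left ?_ hγ
    linarith
  linarith

theorem valueFunction_le (f : X → ℝ) (g : Y → EReal) (c : X → Y) (x : X) (w : Y) :
    valueFunction f g c (c x - w) ≤ f x + g w := by
  refine (iInf_le _ x).trans_eq ?_
  simp

theorem valueFunction_zero (f : X → ℝ) (g : Y → EReal) (c : X → Y) :
    valueFunction f g c 0 = optimalValue f g c := by
  simp [valueFunction, optimalValue, objective]

theorem IsProper.exists_lt_of_valueFunction_lt (hg : IsProper g) {u : Y} {s : ℝ}
    (h : valueFunction f g c u < s) : ∃ (x : X) (r : ℝ), g (c x - u) = r ∧ f x + r < s := by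
  obtain ⟨x, hx⟩ := iInf_lt_iff.1 h
  have h1 : g (c x - u) < ⊤ := by
    refine lt_top_iff_ne_top.2 fun h1 => ?_
    rw [h1, EReal.coe_add_top] at hx
    exact absurd hx (by simp)
  obtain ⟨r, hr⟩ := hg.exists_real h1
  refine ⟨x, r, hr, ?_⟩
  rw [hr] at hx
  exact_mod_cast hx

theorem FullyConvex.exists_optimalValue (hP : FullyConvex f g c) :
    ∃ v : ℝ, optimalValue f g c = v := by
  obtain ⟨x, hx, hmin⟩ := hP.exists_minimizer
  have h1 : optimalValue f g c = objective f g c x := le_antisymm (iInf_le _ x) (le_iInf hmin)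
  have h2 : g (c x) < ⊤ := by
    refine lt_top_iff_ne_top.2 fun h2 => ?_
    simp [dom, objective, h2] at hx
  obtain ⟨r, hr⟩ := hP.g_proper.exists_real h2
  exact ⟨f x + r, by rw [h1, objective, hr]; norm_cast⟩

/-- The deviation of `c` from affinity lies in `hzn g`, so adding it to the convex combination of
arguments does not increase `g`. The infimum need not be attained, hence the slack `δ`. -/
theorem FullyConvex.isConvex_valueFunction (hP : FullyConvex f g c) :
    IsConvex (valueFunction f g c) := by
  rintro ⟨u, s⟩ hu ⟨u', s'⟩ hu' a b ha hb hab
  have hu1 : valueFunction f g c u ≤ s := hu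
  have hu1' : valueFunction f g c u' ≤ s' := hu'
  change valueFunction f g c (a • u + b • u') ≤ ((a * s + b * s' : ℝ) : EReal)
  obtain rfl : b = 1 - a := by linarith
  refine EReal.le_of_forall_lt_iff_le.1 fun t ht => ?_
  have ht' : a * s + (1 - a) * s' < t := by exact_mod_cast ht
  set δ := t - (a * s + (1 - a) * s') with hδ
  have hδ0 : 0 < δ := by rw [hδ]; linarith
  obtain ⟨x, r, hr, hx⟩ := hP.g_proper.exists_lt_of_valueFunction_lt (s := s + δ)
    (hu1.trans_lt (by exact_mod_cast lt_add_of_pos_right s hδ0))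
  obtain ⟨x', r', hr', hx'⟩ := hP.g_proper.exists_lt_of_valueFunction_lt (s := s' + δ)
    (hu1'.trans_lt (by exact_mod_cast lt_add_of_pos_right s' hδ0))
  have h1 := hP.g_convex (x := (c x - u, r)) hr.le (y := (c x' - u', r')) hr'.le ha hb hab
  have hw : g (a • (c x - u) + (1 - a) • (c x' - u')) ≤ ((a * r + (1 - a) * r' : ℝ) : EReal) := h1
  have h2 := hP.c_convex x x' a ha (by linarith) _ (hw.trans_lt (EReal.coe_lt_top _))
  have h3 : a • (c x - u) + (1 - a) • (c x' - u') +
      (c (a • x + (1 - a) • x') - a • c x - (1 - a) • c x') =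
      c (a • x + (1 - a) • x') - (a • u + (1 - a) • u') := by
    rw [smul_sub, smul_sub]; abel
  rw [h3] at h2
  have h4 := hP.f_convex.2 (mem_univ x) (mem_univ x') ha hb hab
  simp only [smul_eq_mul] at h4
  refine (iInf_le _ (a • x + (1 - a) • x')).trans ?_
  refine (add_le_add (EReal.coe_le_coe_iff.2 h4) (h2.trans hw)).trans ?_
  have h5 : a * f x + (1 - a) * f x' + (a * r + (1 - a) * r') ≤ t := by
    have := mul_le_mul_of_nonneg_left hx.le ha
    have := mul_le_mul_of_nonneg_left hx'.le hb
    nlinarith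
  exact_mod_cast h5

/-- The defining inequality of an inexact augmented Lagrangian step, in terms of the value
function. -/
theorem FullyConvex.inexact_step (hP : FullyConvex f g c) {γ ε : ℝ} (hγ : 0 < γ) {x : X} {b z : Y}
    (hx : augLagrangian f g c γ x b ≤ (⨅ x', augLagrangian f g c γ x' b) + (ε : EReal))
    (hz : IsProx (fun w => (γ : EReal) * g w) (c x + γ • b) z) :
    ∃ r : ℝ, g z = r ∧ ∀ u (s : ℝ), valueFunction f g c u ≤ s →
      f x + r + quad γ b (c x - z) ≤ s + quad γ b u + ε := by
  obtain ⟨r, hr, hmin⟩ := hP.g_proper.prox_minimizes hγ hz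
  refine ⟨r, hr, fun u s hs => ?_⟩
  refine le_of_forall_pos_le_add fun δ hδ => ?_
  obtain ⟨x', r', hr', hx'⟩ := hP.g_proper.exists_lt_of_valueFunction_lt (s := s + δ)
    (hs.trans_lt (by exact_mod_cast lt_add_of_pos_right s hδ))
  have h1 : ((f x + (r + quad γ b (c x - z)) : ℝ) : EReal) ≤ augLagrangian f g c γ x b := by
    rw [EReal.coe_add, augLagrangian]
    refine add_le_add le_rfl (le_iInf fun w => ?_)
    rcases eq_or_ne (g w) ⊤ with hw | hw
    · rw [hw, EReal.top_add_coe]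
      exact le_top
    · obtain ⟨t, ht⟩ := hP.g_proper.exists_real (lt_top_iff_ne_top.2 hw)
      rw [ht]
      exact_mod_cast hmin w t ht.le
  have h2 : (⨅ x', augLagrangian f g c γ x' b) ≤ ((f x' + (r' + quad γ b u) : ℝ) : EReal) := by
    refine (iInf_le _ x').trans ?_
    rw [EReal.coe_add, augLagrangian]
    refine add_le_add le_rfl ((iInf_le _ (c x' - u)).trans ?_)
    rw [hr', sub_sub_cancel]
    norm_cast
  have h3 := (h1.trans hx).trans (add_le_add_left h2 _)
  have h4 : f x + (r + quad γ b (c x - z)) ≤ f x' + (r' + quad γ b u) + ε := by exact_mod_cast h3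
  linarith

/-- If the value function has a subgradient at the origin, then every minimizer is stationary. -/
theorem FullyConvex.isStationaryPoint_of_subgradAt (hP : FullyConvex f g c) {v : ℝ} {y : Y}
    (hs : SubgradAt (valueFunction f g c) 0 v (-y)) {x : X}
    (hx : IsMinimizer (objective f g c) x) : IsStationaryPoint f g c x := by
  have h1 : optimalValue f g c = objective f g c x :=
    le_antisymm (iInf_le _ x) (le_iInf hx.2)
  have h2 : g (c x) < ⊤ := by
    refine lt_top_iff_ne_top.2 fun h2 => ?_
    have := hx.1
    simp [dom, objective, h2] at this
  obtain ⟨r, hr⟩ := hP.g_proper.exists_real h2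
  have hv : f x + r = v := by
    have h3 := hs.1
    rw [valueFunction_zero, h1, objective, hr] at h3
    exact_mod_cast h3
  -- The subgradient inequality at `c x' - w`. Fixing `w = c x` gives the vanishing gradient; fixing
  -- `x' = x` gives equality in Fenchel–Young.
  have key : ∀ x' w (t : ℝ), g w = t →
      f x + r ≤ f x' + t + inner ℝ y (c x' - w) := by
    intro x' w t ht
    have h3 := valueFunction_le f g c x' w
    rw [ht] at h3
    have h4 := hs.2 (c x' - w) (f x' + t) (by exact_mod_cast h3)
    rw [sub_zero, inner_neg_left] at h4
    linarith
  refine ⟨hx.1, y, ?_, ?_⟩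
  · have hd : DifferentiableAt ℝ (fun x' => f x' + inner ℝ y (c x')) x :=
      ((hP.f_smooth.differentiable one_ne_zero) x).add
        ((differentiableAt_const y).inner ℝ ((hP.c_smooth.differentiable one_ne_zero) x))
    have hmin : IsLocalMin (fun x' => f x' + inner ℝ y (c x')) x := by
      refine Eventually.of_forall fun x' => ?_
      have := key x' (c x) r hr
      rw [inner_sub_right] at this
      simp only
      linarith
    have := hd.hasFDerivAt
    rwa [hmin.fderiv_eq_zero] at this
  · have hconj : conj g y = ((inner ℝ (c x) y - r : ℝ) : EReal) := by
      refine le_antisymm (iSup_le fun w => ?_) ?_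
      · rcases eq_or_ne (g w) ⊤ with hw | hw
        · rw [hw]
          simp
        · obtain ⟨t, ht⟩ := hP.g_proper.exists_real (lt_top_iff_ne_top.2 hw)
          have h3 := key x w t ht
          rw [inner_sub_right] at h3
          rw [ht]
          have : inner ℝ w y - t ≤ inner ℝ (c x) y - r := by
            rw [real_inner_comm y w, real_inner_comm y (c x)]
            linarith
          exact_mod_cast this
      · refine le_trans ?_ (le_iSup _ (c x))
        rw [hr]
        norm_cast
    refine ⟨by rw [hconj]; exact EReal.coe_ne_top _, by rw [hconj]; exact EReal.coe_ne_bot _,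
      fun y' _ => ?_⟩
    refine le_trans ?_ (le_iSup _ (c x))
    rw [hconj, hr]
    have : inner ℝ (c x) y - r + inner ℝ (c x) (y' - y) ≤ inner ℝ (c x) y' - r := by
      rw [inner_sub_right]
      linarith
    exact_mod_cast this

/-- Fenchel–Young for `V`, as `-M(y)` is the conjugate of `V` at `-y`; a subgradient gives the
reverse bound in `IsProper.le_dualFunction`. -/
theorem IsProper.dualFunction_le (hg : IsProper g) {u : Y} {r : ℝ}
    (hu : valueFunction f g c u = r) (y : Y) :
    dualFunction f g c y ≤ ((r + inner ℝ y u : ℝ) : EReal) := by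
  refine EReal.le_of_forall_lt_iff_le.1 fun t ht => ?_
  have ht' : r + inner ℝ y u < t := by exact_mod_cast ht
  obtain ⟨x, q, hq, hx⟩ := hg.exists_lt_of_valueFunction_lt (f := f) (c := c) (u := u)
    (s := t - inner ℝ y u) (by rw [hu]; exact_mod_cast lt_sub_iff_add_lt.2 ht')
  refine (iInf_le _ x).trans ((add_le_add le_rfl (iInf_le _ (c x - u))).trans ?_)
  rw [hq, sub_sub_cancel]
  have : f x + (q + inner ℝ y u) ≤ t := by linarith
  exact_mod_cast this

theorem IsProper.le_dualFunction (hg : IsProper g) {u y : Y} {r : ℝ}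
    (hu : SubgradAt (valueFunction f g c) u r (-y)) :
    ((r + inner ℝ y u : ℝ) : EReal) ≤ dualFunction f g c y := by
  refine le_iInf fun x => ?_
  have h1 : r + inner ℝ y u = f x + (r + inner ℝ y u - f x) := by ring
  rw [h1, EReal.coe_add, lagrangian]
  refine add_le_add le_rfl (le_iInf fun w => ?_)
  rcases eq_or_ne (g w) ⊤ with hw | hw
  · rw [hw, EReal.top_add_coe]
    exact le_top
  · obtain ⟨t, ht⟩ := hg.exists_real (lt_top_iff_ne_top.2 hw)
    have h3 := valueFunction_le f g c x w
    rw [ht] at h3 ⊢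
    have h4 := hu.2 (c x - w) (f x + t) (by exact_mod_cast h3)
    rw [inner_neg_left, inner_sub_right] at h4
    have h5 : r + inner ℝ y u - f x ≤ t + inner ℝ y (c x - w) := by linarith
    exact_mod_cast h5

/-- Fixed points of the exact safeguarded method solve the penalized dual problem. -/
theorem IsProper.isMinimizer_penalizedDual (hg : IsProper g) {C : Set Y} (hC : Convex ℝ C)
    (hCc : IsCompact C) (hne : C.Nonempty) {γ : ℝ} (hγ : 0 < γ) {u y p : Y} {r : ℝ}
    (hp : IsProjection C y p) (hy : p + γ⁻¹ • u = y)
    (hu : SubgradAt (valueFunction f g c) u r (-y)) :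
    IsMinimizer (penalizedDual f g c C γ) y := by
  have hD : dualFunction f g c y = ((r + inner ℝ y u : ℝ) : EReal) :=
    le_antisymm (hg.dualFunction_le hu.1 y) (hg.le_dualFunction hu)
  have hval : penalizedDual f g c C γ y =
      ((-(r + inner ℝ y u) + γ / 2 * Metric.infDist y C ^ 2 : ℝ) : EReal) := by
    rw [penalizedDual, hD]
    norm_cast
  refine ⟨by rw [dom, mem_ofPred_eq, hval]; exact EReal.coe_lt_top _, fun y' => ?_⟩
  rw [hval, penalizedDual]
  obtain ⟨q, hq⟩ := exists_isProjection hCc hne y'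
  -- The penalty has gradient `γ • (y - p) = u` at `y`, and `-u` is a subgradient of `-M` there; the
  -- two cancel.
  have h1 := hp.half_sq_infDist_le hC hq
  have h2 : y - p = γ⁻¹ • u := by rw [← hy]; abel
  rw [h2, inner_smul_left, inner_sub_right, real_inner_comm y' u, real_inner_comm y u] at h1
  have h3 := mul_le_mul_of_nonneg_left h1 hγ.le
  simp only [conj_trivial] at h3
  rw [mul_add, ← mul_assoc γ γ⁻¹, mul_inv_cancel₀ hγ.ne', one_mul] at h3
  have h4 : -(r + inner ℝ y u) + γ / 2 * Metric.infDist y C ^ 2 ≤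
      -(r + inner ℝ y' u) + γ / 2 * Metric.infDist y' C ^ 2 := by linarith
  have h5 : ((-(r + inner ℝ y' u) : ℝ) : EReal) ≤ -dualFunction f g c y' := by
    rw [EReal.coe_neg]
    exact EReal.neg_le_neg_iff.2 (hg.dualFunction_le hu.1 y')
  refine (EReal.coe_le_coe_iff.2 h4).trans ?_
  rw [EReal.coe_add]
  exact add_le_add h5 le_rfl

end Composite

/-! ### Convergence of the safeguarded method -/

section Convergence

theorem SubgradAt.norm_sub_le_of_inexact {H : Type*} [NormedAddCommGroup H]
    [InnerProductSpace ℝ H] {h : H → EReal} {γ : ℝ} (hγ : 0 < γ) {a ubar : H} {r : ℝ}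
    (hs : SubgradAt h ubar r (-(a + γ⁻¹ • ubar))) {u : H} {s ε : ℝ} (hu : h u ≤ s)
    (hε : s + quad γ a u ≤ r + quad γ a ubar + ε) :
    ‖u - ubar‖ ≤ γ * (√2 * √(ε / γ)) := by
  have h1 := hs.quad_growth hγ hu
  have h2 : 1 / (2 * γ) * ‖u - ubar‖ ^ 2 ≤ ε := by linarith
  have hε0 : 0 ≤ ε := le_trans (by positivity) h2
  refine le_of_sq_le_sq ?_ (by positivity)
  rw [mul_pow, mul_pow, Real.sq_sqrt (by norm_num), Real.sq_sqrt (by positivity)]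
  rw [div_mul_eq_mul_div, div_le_iff₀ (by positivity)] at h2
  have : γ ^ 2 * (2 * (ε / γ)) = ε * (2 * γ) := by field_simp
  linarith

variable {X Y : Type*} [NormedAddCommGroup X] [InnerProductSpace ℝ X]
  [NormedAddCommGroup Y] [InnerProductSpace ℝ Y] {f : X → ℝ} {g : Y → EReal} {c : X → Y}
  {Ysg : Set Y} {β : ℝ} {μ ε : ℕ → ℝ} {x : ℕ → X} {z y yhat : ℕ → Y}

namespace IsSafeguardedALM

theorem μ_pos (hA : IsSafeguardedALM f g c Ysg β μ ε x z y yhat) (k : ℕ) : 0 < μ k := by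
  induction k with
  | zero => exact hA.μ_zero_pos
  | succ k ih =>
    obtain ⟨b, hb, h⟩ := hA.μ_update k
    rw [h]
    rcases hb with hb | rfl
    · exact mul_pos hb.1 ih
    · simpa using ih

theorem μ_antitone (hA : IsSafeguardedALM f g c Ysg β μ ε x z y yhat) : Antitone μ := by
  refine antitone_nat_of_succ_le fun k => ?_
  obtain ⟨b, hb, h⟩ := hA.μ_update k
  have hb1 : b ≤ 1 := by
    rcases hb with hb | rfl
    · exact hb.2.trans hA.β_lt_one.le
    · exact le_rfl
  rw [h]
  exact mul_le_of_le_one_left (hA.μ_pos k).le hb1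

/-- Once `μ k < m / β`, a genuine reduction would fall below the limit `m`. -/
theorem μ_eventually_const (hA : IsSafeguardedALM f g c Ysg β μ ε x z y yhat) {m : ℝ}
    (hm : 0 < m) (hlim : Tendsto μ atTop (𝓝 m)) : ∃ N, ∀ k, N ≤ k → μ k = m := by
  have h1 : m < m / β := by
    rw [lt_div_iff₀ hA.β_pos]
    exact mul_lt_of_lt_one_right hm hA.β_lt_one
  obtain ⟨N, hN⟩ := eventually_atTop.1 (hlim.eventually_lt_const h1)
  have hge : ∀ k, m ≤ μ k := fun k => hA.μ_antitone.le_of_tendsto hlim k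
  have hstep : ∀ k, N ≤ k → μ (k + 1) = μ k := by
    intro k hk
    obtain ⟨b, hb, h⟩ := hA.μ_update k
    rcases hb with hb | rfl
    · have h2 := hN k hk
      rw [lt_div_iff₀ hA.β_pos] at h2
      have h3 := mul_le_mul_of_nonneg_right hb.2 (hA.μ_pos k).le
      have h4 := hge (k + 1)
      linarith
    · rw [h, one_mul]
  have hconst : ∀ k, N ≤ k → μ k = μ N := by
    intro k hk
    induction k, hk using Nat.le_induction with
    | base => rfl
    | succ k hk ih => rw [hstep k hk, ih]
  have h5 : μ N = m := by
    refine tendsto_nhds_unique ?_ hlim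
    refine tendsto_const_nhds.congr' ?_
    filter_upwards [eventually_ge_atTop N] with k hk
    exact (hconst k hk).symm
  exact ⟨N, fun k hk => (hconst k hk).trans h5⟩

theorem exists_norm_yhat_le (hA : IsSafeguardedALM f g c Ysg β μ ε x z y yhat) :
    ∃ R, 0 ≤ R ∧ ∀ k, ‖yhat k‖ ≤ R := by
  obtain ⟨R, hR⟩ := hA.compact_Ysg.isBounded.exists_norm_le
  exact ⟨R, (norm_nonneg _).trans (hR _ (hA.safeguard 0).1), fun k => hR _ (hA.safeguard k).1⟩

theorem exists_step (hA : IsSafeguardedALM f g c Ysg β μ ε x z y yhat)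
    (hP : FullyConvex f g c) : ∃ r : ℕ → ℝ, (∀ k, g (z k) = r k) ∧
      (∀ k, valueFunction f g c (c (x k) - z k) ≤ ((f (x k) + r k : ℝ) : EReal)) ∧
      ∀ k u (s : ℝ), valueFunction f g c u ≤ s →
        f (x k) + r k + quad (μ k) (yhat k) (c (x k) - z k) ≤ s + quad (μ k) (yhat k) u + ε k := by
  have h := fun k => hP.inexact_step (hA.μ_pos k) (hA.subproblem k) (hA.z_update k)
  choose r hr h using h
  refine ⟨r, hr, fun k => ?_, h⟩
  have h1 := valueFunction_le f g c (x k) (z k)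
  rw [hr] at h1
  exact_mod_cast h1

theorem ε_tendsto_zero (hA : IsSafeguardedALM f g c Ysg β μ ε x z y yhat)
    (hsum : Summable fun k => √(ε k / μ k)) {m : ℝ} (hμ : Tendsto μ atTop (𝓝 m)) :
    Tendsto ε atTop (𝓝 0) := by
  have h1 := (hsum.tendsto_atTop_zero.pow 2).mul hμ
  rw [zero_pow two_ne_zero, zero_mul] at h1
  refine h1.congr fun k => ?_
  rw [Real.sq_sqrt (div_nonneg (hA.ε_nonneg k) (hA.μ_pos k).le),
    div_mul_cancel₀ _ (hA.μ_pos k).ne']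

/-- With vanishing penalty parameters, the objective is asymptotically at most optimal. -/
theorem exists_upper_bound (hA : IsSafeguardedALM f g c Ysg β μ ε x z y yhat)
    (hP : FullyConvex f g c) (hsum : Summable fun k => √(ε k / μ k))
    (hμ : Tendsto μ atTop (𝓝 0)) :
    ∃ B : ℕ → EReal, Tendsto B atTop (𝓝 (optimalValue f g c)) ∧
      ∀ k, (f (x k) : EReal) + g (z k) ≤ B k := by
  obtain ⟨v, hv⟩ := hP.exists_optimalValue
  obtain ⟨r, hr, -, hstep⟩ := hA.exists_step hP
  obtain ⟨R, hR0, hR⟩ := hA.exists_norm_yhat_le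
  refine ⟨fun k => ((v + ε k + μ k / 2 * R ^ 2 : ℝ) : EReal), ?_, fun k => ?_⟩
  · rw [hv]
    refine (continuous_coe_real_ereal.tendsto v).comp ?_
    simpa using ((hA.ε_tendsto_zero hsum hμ).const_add v).add ((hμ.div_const 2).mul_const (R ^ 2))
  · have h1 := hstep k 0 v (by rw [valueFunction_zero, hv])
    have h2 := neg_le_quad (hA.μ_pos k) (yhat k) (c (x k) - z k)
    have h3 : μ k / 2 * ‖yhat k‖ ^ 2 ≤ μ k / 2 * R ^ 2 := by
      have := (hA.μ_pos k).le
      have := hR k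
      gcongr
    rw [quad_zero] at h1
    rw [hr]
    have h4 : f (x k) + r k ≤ v + ε k + μ k / 2 * R ^ 2 := by linarith
    change ((f (x k) : EReal) + ((r k : ℝ) : EReal)) ≤ ((v + ε k + μ k / 2 * R ^ 2 : ℝ) : EReal)
    exact_mod_cast h4

/-- With vanishing penalty parameters, the constraint residuals vanish. -/
theorem residual_tendsto_zero (hA : IsSafeguardedALM f g c Ysg β μ ε x z y yhat)
    (hP : FullyConvex f g c) (hlsc : LowerSemicontinuous (valueFunction f g c))
    (hsum : Summable fun k => √(ε k / μ k)) (hμ : Tendsto μ atTop (𝓝 0)) :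
    Tendsto (fun k => c (x k) - z k) atTop (𝓝 0) := by
  obtain ⟨v, hv⟩ := hP.exists_optimalValue
  have h0 : valueFunction f g c 0 = v := by rw [valueFunction_zero, hv]
  obtain ⟨r, -, hval, hstep⟩ := hA.exists_step hP
  obtain ⟨R, hR0, hR⟩ := hA.exists_norm_yhat_le
  obtain ⟨b, hb, hmin⟩ := hP.isConvex_valueFunction.exists_norm_minorant hlsc h0
  have hbound : ∀ k, ‖c (x k) - z k‖ ^ 2 ≤
      4 * μ k * (1 + ε k) + 4 * μ k ^ 2 * (b + R) ^ 2 := by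
    intro k
    have hpos := hA.μ_pos k
    set u := c (x k) - z k with hu
    have h1 := hstep k 0 v h0.le
    have h2 := hmin u _ (hval k)
    have h3 : -(‖yhat k‖ * ‖u‖) ≤ inner ℝ (yhat k) u :=
      (abs_le.1 (abs_real_inner_le_norm _ _)).1
    have h4 := mul_le_mul_of_nonneg_right (hR k) (norm_nonneg u)
    rw [quad_zero, quad] at h1
    have h5 : 1 / (2 * μ k) * ‖u‖ ^ 2 ≤ 1 + ε k + (b + R) * ‖u‖ := by linarith
    rw [div_mul_eq_mul_div, div_le_iff₀ (by positivity)] at h5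
    -- Young's inequality absorbs the term linear in `‖u‖` into half of `‖u‖ ^ 2`.
    nlinarith [sq_nonneg (‖u‖ - 2 * μ k * (b + R))]
  have hlim : Tendsto (fun k => 4 * μ k * (1 + ε k) + 4 * μ k ^ 2 * (b + R) ^ 2) atTop (𝓝 0) := by
    have h1 := (((hμ.const_mul 4).mul ((hA.ε_tendsto_zero hsum hμ).const_add 1)).add
      (((hμ.pow 2).const_mul 4).mul_const ((b + R) ^ 2)))
    simpa using h1
  rw [tendsto_zero_iff_norm_tendsto_zero]
  simpa using (squeeze_zero (fun k => sq_nonneg _) hbound hlim).sqrt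

theorem norm_y_tendsto_atTop [FiniteDimensional ℝ Y]
    (hA : IsSafeguardedALM f g c Ysg β μ ε x z y yhat) (hP : FullyConvex f g c)
    (hirr : ∀ xbar, IsMinimizer (objective f g c) xbar → ¬ IsStationaryPoint f g c xbar)
    (hlsc : LowerSemicontinuous (valueFunction f g c))
    (hsum : Summable fun k => √(ε k / μ k)) (hμ : Tendsto μ atTop (𝓝 0)) :
    Tendsto (fun k => ‖y k‖) atTop atTop := by
  have : ProperSpace Y := FiniteDimensional.proper_real Y
  obtain ⟨v, hv⟩ := hP.exists_optimalValue
  have h0 : valueFunction f g c 0 = v := by rw [valueFunction_zero, hv]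
  obtain ⟨r, -, hval, hstep⟩ := hA.exists_step hP
  have hex := fun k =>
    hP.isConvex_valueFunction.exists_subgradAt hlsc h0 (hA.μ_pos k) (yhat k)
  choose ubar q hsub using hex
  have herr : ∀ k, ‖c (x k) - z k - ubar k‖ ≤ μ k * (√2 * √(ε k / μ k)) := fun k =>
    (hsub k).norm_sub_le_of_inexact (hA.μ_pos k) (hval k) (hstep k _ _ (hsub k).1.le)
  have hlim0 : Tendsto (fun k => √2 * √(ε k / μ k)) atTop (𝓝 0) := by
    simpa using hsum.tendsto_atTop_zero.const_mul (√2)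
  have hubar : Tendsto ubar atTop (𝓝 0) := by
    have h1 : Tendsto (fun k => c (x k) - z k - ubar k) atTop (𝓝 0) :=
      squeeze_zero_norm herr (by simpa using hμ.mul hlim0)
    have h2 := (hA.residual_tendsto_zero hP hlsc hsum hμ).sub h1
    simpa using h2
  -- The factor `μ k` in `herr` cancels the blow-up of `(μ k)⁻¹`.
  have hy : Tendsto (fun k => y (k + 1) - (yhat k + (μ k)⁻¹ • ubar k)) atTop (𝓝 0) := by
    refine squeeze_zero_norm (fun k => ?_) hlim0
    have hpos := hA.μ_pos k
    rw [hA.y_update, add_sub_add_left_eq_sub, ← smul_sub, norm_smul,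
      Real.norm_of_nonneg (by positivity), inv_mul_le_iff₀ hpos]
    exact herr k
  refine (tendsto_add_atTop_iff_nat 1).1 ?_
  by_contra hnot
  obtain ⟨R, hR⟩ : ∃ R, ∃ᶠ k in atTop, ‖y (k + 1)‖ < R := by
    rw [tendsto_atTop] at hnot
    push Not at hnot
    simpa using hnot
  obtain ⟨κ, hκ, hκR⟩ := extraction_of_frequently_atTop hR
  obtain ⟨w, -, ψ, hψ, hw⟩ := (isCompact_closedBall (0 : Y) R).tendsto_subseq
    (x := fun j => y (κ j + 1)) fun j => by simpa using (hκR j).le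
  have hlim := (hκ.comp hψ).tendsto_atTop
  have hybar := hw.sub (hy.comp hlim)
  have hlimit : SubgradAt (valueFunction f g c) 0 v (-w) := by
    refine SubgradAt.of_tendsto hlsc (fun j => hsub (κ (ψ j))) h0 (hubar.comp hlim) ?_
    refine Tendsto.neg ?_
    rw [sub_zero] at hybar
    refine hybar.congr fun j => ?_
    simp
  obtain ⟨xbar, hx⟩ := hP.exists_minimizer
  exact hirr xbar hx (hP.isStationaryPoint_of_subgradAt hlimit hx)

/-- Lower semicontinuity of `f + g` in the pair `(x, z)` gives the lower bound `Φ(xbar)`;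
`exists_upper_bound` gives the optimal value from above, so the two coincide. -/
theorem subseq_tendsto (hA : IsSafeguardedALM f g c Ysg β μ ε x z y yhat)
    (hP : FullyConvex f g c) (hlsc : LowerSemicontinuous (valueFunction f g c))
    (hsum : Summable fun k => √(ε k / μ k)) (hμ : Tendsto μ atTop (𝓝 0)) {xbar : X} {κ : ℕ → ℕ}
    (hκ : StrictMono κ) (hx : Tendsto (fun j => x (κ j)) atTop (𝓝 xbar)) :
    IsMinimizer (objective f g c) xbar ∧
      Tendsto (fun j => z (κ j)) atTop (𝓝 (c xbar)) ∧
      Tendsto (fun j => (f (x (κ j)) : EReal) + g (z (κ j))) atTop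
        (𝓝 (optimalValue f g c)) := by
  obtain ⟨v, hv⟩ := hP.exists_optimalValue
  have hz : Tendsto (fun j => z (κ j)) atTop (𝓝 (c xbar)) := by
    have h1 := ((hP.c_smooth.continuous.tendsto xbar).comp hx).sub
      ((hA.residual_tendsto_zero hP hlsc hsum hμ).comp hκ.tendsto_atTop)
    rw [sub_zero] at h1
    refine h1.congr fun j => ?_
    simp
  obtain ⟨B, hB, hle⟩ := hA.exists_upper_bound hP hsum hμ
  have hBκ := hB.comp hκ.tendsto_atTop
  have hF : LowerSemicontinuous fun p : X × Y => (f p.1 : EReal) + g p.2 := by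
    refine LowerSemicontinuous.add' ?_ ?_ fun p =>
      EReal.continuousAt_add (Or.inl (EReal.coe_ne_top _)) (Or.inl (EReal.coe_ne_bot _))
    · exact (continuous_coe_real_ereal.comp
        (hP.f_smooth.continuous.comp continuous_fst)).lowerSemicontinuous
    · exact hP.g_lsc.comp continuous_snd
  have hlow : ∀ q < objective f g c xbar,
      ∀ᶠ j in atTop, q < (f (x (κ j)) : EReal) + g (z (κ j)) := fun q hq =>
    (hx.prodMk_nhds hz).eventually (hF (xbar, c xbar) q hq)
  have hopt : objective f g c xbar ≤ optimalValue f g c := by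
    refine le_of_forall_lt_imp_le_of_dense fun q hq => ?_
    refine ge_of_tendsto hBκ ?_
    filter_upwards [hlow q hq] with j hj
    exact hj.le.trans (hle _)
  refine ⟨⟨?_, fun x' => hopt.trans (iInf_le _ x')⟩, hz, tendsto_order.2 ⟨fun q hq => ?_,
    fun q hq => ?_⟩⟩
  · exact hopt.trans_lt (by rw [hv]; exact EReal.coe_lt_top _)
  · exact hlow q (hq.trans_le (iInf_le _ xbar))
  · filter_upwards [hBκ.eventually_lt_const hq] with j hj
    exact (hle _).trans_lt hj

theorem tendsto_solution_penalizedDual [FiniteDimensional ℝ Y]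
    (hA : IsSafeguardedALM f g c Ysg β μ ε x z y yhat) (hP : FullyConvex f g c)
    (hlsc : LowerSemicontinuous (valueFunction f g c))
    (hsum : Summable fun k => √(ε k / μ k)) {m : ℝ} (hm : 0 < m) (hμ : Tendsto μ atTop (𝓝 m)) :
    ∃ ybar, IsMinimizer (penalizedDual f g c Ysg m) ybar ∧ Tendsto y atTop (𝓝 ybar) := by
  obtain ⟨v, hv⟩ := hP.exists_optimalValue
  have h0 : valueFunction f g c 0 = v := by rw [valueFunction_zero, hv]
  obtain ⟨r, -, hval, hstep⟩ := hA.exists_step hP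
  choose U q hU using fun a => hP.isConvex_valueFunction.exists_subgradAt hlsc h0 hm a
  choose P hPr using fun a => exists_isProjection hA.compact_Ysg hA.nonempty_Ysg a
  have hT := firmlyNonexpansive_of_subgradAt hm hU
  have hPf : FirmlyNonexpansive P := fun a b => (hPr a).firm hA.convex_Ysg (hPr b)
  have hyhat : ∀ k, yhat k = P (y k) := fun k =>
    (hA.safeguard k).unique hA.convex_Ysg (hPr (y k))
  obtain ⟨R, hR⟩ := hA.compact_Ysg.isBounded.exists_norm_le
  -- Compactness of `Ysg` bounds the range of `P`, and nonexpansiveness bounds its image, so dual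
  -- solvability need not be assumed.
  have hfix : ∃ p, P p + m⁻¹ • U (P p) = p := by
    refine exists_fixedPoint_of_nonexpansive (F := fun a => P a + m⁻¹ • U (P a))
      (R := R + R + ‖P 0 + m⁻¹ • U (P 0)‖)
      (fun a b => (hT.norm_sub_le _ _).trans (hPf.norm_sub_le _ _)) fun a => ?_
    have h1 := hT.norm_sub_le (P a) (P 0)
    have h2 := norm_sub_le (P a) (P 0)
    have h3 := hR _ (hPr a).1
    have h4 := hR _ (hPr 0).1
    have h5 := norm_le_norm_sub_add (P a + m⁻¹ • U (P a)) (P 0 + m⁻¹ • U (P 0))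
    linarith
  obtain ⟨N, hN⟩ := hA.μ_eventually_const hm hμ
  have hsum' : Summable fun k => √2 * √(ε (k + N) / μ (k + N)) :=
    ((summable_nat_add_iff N).2 hsum).mul_left _
  obtain ⟨p, hp, hlim⟩ := tendsto_fixedPoint_of_summable_errors (y := fun k => y (k + N)) hT hPf
    hfix hsum' fun k => by
      have hk : μ (k + N) = m := hN _ (Nat.le_add_left _ _)
      have h1 := hstep (k + N) _ _ (hU (yhat (k + N))).1.le
      rw [hk] at h1
      have h2 := (hU (yhat (k + N))).norm_sub_le_of_inexact hm (hval (k + N)) h1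
      have h3 : k + 1 + N = k + N + 1 := by ring
      rw [h3, hA.y_update, ← hyhat, hk, add_sub_add_left_eq_sub, ← smul_sub, norm_smul,
        Real.norm_of_nonneg (by positivity), inv_mul_le_iff₀ hm]
      exact h2
  refine ⟨p, ?_, (tendsto_add_atTop_iff_nat N).1 hlim⟩
  refine hP.g_proper.isMinimizer_penalizedDual hA.convex_Ysg hA.compact_Ysg hA.nonempty_Ysg hm
    (hPr p) hp (u := U (P p)) (r := q (P p)) ?_
  have h1 := hU (P p)
  rwa [hp] at h1

end IsSafeguardedALM

end Convergence

end CompositeALM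

open CompositeALM
theorem theorem5p8
    {X Y : Type*}
    [NormedAddCommGroup X] [InnerProductSpace ℝ X] [FiniteDimensional ℝ X]
    [NormedAddCommGroup Y] [InnerProductSpace ℝ Y] [FiniteDimensional ℝ Y]
    (f : X → ℝ) (g : Y → EReal) (c : X → Y)
    (hP : FullyConvex f g c)
    (hirr : ∀ xbar, IsMinimizer (objective f g c) xbar → ¬ IsStationaryPoint f g c xbar)
    (hVproper : IsProper (valueFunction f g c))
    (hVlsc : LowerSemicontinuous (valueFunction f g c))
    (Ysg : Set Y) (β : ℝ) (μ ε : ℕ → ℝ) (x : ℕ → X) (z y yhat : ℕ → Y)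
    (hALM : IsSafeguardedALM f g c Ysg β μ ε x z y yhat)
    (hsum : Summable fun k => Real.sqrt (ε k / μ k))
    (μlim : ℝ) (hμlim_nonneg : 0 ≤ μlim)
    (hμlim : Tendsto μ atTop (𝓝 μlim)) :
    (μlim = 0 →
      Tendsto (fun k => ‖y k‖) atTop atTop ∧
      limsup (fun k => (f (x k) : EReal) + g (z k)) atTop ≤ optimalValue f g c ∧
      (∀ xbar : X, MapClusterPt xbar atTop x → IsMinimizer (objective f g c) xbar) ∧
      (∀ (xbar : X) (κ : ℕ → ℕ), StrictMono κ →
        Tendsto (fun j => x (κ j)) atTop (𝓝 xbar) →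
          Tendsto (fun j => z (κ j)) atTop (𝓝 (c xbar)) ∧
          Tendsto (fun j => (f (x (κ j)) : EReal) + g (z (κ j))) atTop
            (𝓝 (optimalValue f g c)))) ∧
    (0 < μlim →
      ∃ ybar : Y, IsMinimizer (penalizedDual f g c Ysg μlim) ybar ∧
        Tendsto y atTop (𝓝 ybar)) := by
  refine ⟨fun h0 => ?_, fun hpos => hALM.tendsto_solution_penalizedDual hP hVlsc hsum hpos hμlim⟩
  subst h0
  refine ⟨hALM.norm_y_tendsto_atTop hP hirr hVlsc hsum hμlim, ?_, fun xbar hx => ?_,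
    fun xbar κ hκ hx => (hALM.subseq_tendsto hP hVlsc hsum hμlim hκ hx).2⟩
  · obtain ⟨B, hB, hle⟩ := hALM.exists_upper_bound hP hsum hμlim
    exact (limsup_le_limsup (Eventually.of_forall hle)).trans hB.limsup_eq.le
  · obtain ⟨κ, hκ, hlim⟩ := hx.tendsto_subseq
    exact (hALM.subseq_tendsto hP hVlsc hsum hμlim hκ hlim).1
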